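/- Let $\sigma(x)=\max\{x,0\}$. A ReLU network with $L$ hidden layers and width vector $(n_0,n_1,\dots,n_{L+1})$ is a function $W_{L+1}\circ\sigma\circ W_L\circ\sigma\circ\cdots\circ\sigma\circ W_1:\mathbb R^{n_0}\to\mathbb R^{n_{L+1}}$, where each $W_i:\mathbb R^{n_{i-1}}\to\mathbb R^{n_i}$ is affine and $\sigma$ acts coordinatewise. For a continuous function $g$ on $\mathbb R^n$ put $\|g\|_\infty=\max\{|g(x)|:x\in[0,1]^n\}$. Let $m\ge 0$ and $k\ge 1$ be integers, and let $f\in C^1(\mathbb R^n)$ have support in $[0,1]^n$. (a) Let $n\ge 2$, let $q=\lfloor\log_2 n\rfloor+1$ or $q=\lceil\log_2 n\rceil$ (the least integer $\ge\log_2 n$), and let $L=(m+5)q+3$. There is a ReLU network $F$ with $L$ hidden layers and width vector $$(n,\;3n(2k+1),\;n(2k+1),\;\underbrace{6n(2k+1)^n,\dots,6n(2k+1)^n}_{(m+5)q},\;(2k+1)^n,\;1)$$ such that $$\sup_{x\in[0,1]^n}|f(x)-F(x)|\le \|f\|_\infty\,3^n\,2^{-m}(2k+1)+\max_{1\le j\le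 n}\|\partial_{x_j}f\|_\infty\,\frac{n}{2k}.$$ Moreover $F$ can be chosen locally connected in the following sense. The units of the first hidden layer can be labelled by $(j,a,s)$ and those of the second by $(j,a)$, where $1\le j\le n$, $-k\le a\le k$, $1\le s\le 3$; the units of each of the layers $3,\dots,L-1$ by $(\mathbf i,t)$ and those of layer $L$ by $\mathbf i$, where $\mathbf i\in\{-k,\dots,k\}^n$, $1\le t\le 6n$. The only nonzero weights in the hidden layers are then those by which, in layer 1, $(j,a,s)$ depends on the input $x_j$; in layer 2, $(j,a)$ depends on the three units $(j,a,\cdot)$; in layer 3, $(\mathbf i,t)$ depends on the $n$ units $(j,i_j)$, $1\le j\le n$; in layers $4,\dots,L-1$, $(\mathbf i,t)$ depends on the $6n$ units $(\mathbf i,\cdot)$; in layer $L$, $\mathbf i$ depends on the $6n$ units $(\mathbf i,\cdot)$. (b) Let $n=1$. There is a ReLU network $F$ with two hidden layers and width vector $(1,3(2k+1),2k+1,1)$ such that $$\sup_{x\in[0,1]}|f(x)-F(x)|\le\frac{\|f'\|_\infty}{2k},$$ and such that each unit of the second hidden layer is connected to only three units of the first, these triples being disjoint for different units. -/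

import Mathlib

/-- The rectified linear unit `σ(x) = max {x, 0}`. -/
noncomputable def relu (x : ℝ) : ℝ := max x 0

/-- `ReLUNet a hs b` is the type of weights of a feedforward network with input dimension `a`,
output dimension `b` and hidden layers of widths `hs = [n₁, …, n_L]`, that is, with width vector
`(a, n₁, …, n_L, b)`. Every layer has a weight matrix and a bias vector (the last column of the
weight matrix when the affine map is written with an `n_i × (n_{i-1} + 1)` matrix). -/
inductive ReLUNet : ℕ → List ℕ → ℕ → Type
  | output {a b : ℕ} (W : Matrix (Fin b) (Fin a) ℝ) (c : Fin b → ℝ) : ReLUNet a [] b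
  | hidden {a h b : ℕ} {hs : List ℕ} (W : Matrix (Fin h) (Fin a) ℝ) (c : Fin h → ℝ)
      (N : ReLUNet h hs b) : ReLUNet a (h :: hs) b

namespace ReLUNet

/-- The function `W_{L+1} ∘ σ ∘ W_L ∘ σ ∘ ⋯ ∘ σ ∘ W_1` of a network, with affine `W_i` and with
`σ` applied coordinatewise. -/
noncomputable def eval : {a : ℕ} → {hs : List ℕ} → {b : ℕ} → ReLUNet a hs b →
    (Fin a → ℝ) → (Fin b → ℝ)
  | _, _, _, output W c, x => fun i => (∑ j, W i j * x j) + c i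
  | _, _, _, hidden W c N, x => N.eval (fun i => relu ((∑ j, W i j * x j) + c i))

/-- The number `L` of hidden layers. -/
def depth {a : ℕ} {hs : List ℕ} {b : ℕ} (_N : ReLUNet a hs b) : ℕ := hs.length

/-- `N.ConnectedWithin [p₁, …, p_L]`: the network has `L` hidden layers, and in the `l`-th of them
the unit number `u` is connected (by a nonzero weight) to the unit number `v` of the preceding
layer only if `p_l u v`. Units are numbered from zero. The output layer is not restricted. -/
def ConnectedWithin : {a : ℕ} → {hs : List ℕ} → {b : ℕ} → ReLUNet a hs b →
    List (ℕ → ℕ → Prop) → Prop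
  | _, _, _, output _ _, [] => True
  | _, _, _, output _ _, _ :: _ => False
  | _, _, _, hidden _ _ _, [] => False
  | _, _, _, hidden W _ N, p :: ps => (∀ u v, W u v ≠ 0 → p u v) ∧ N.ConnectedWithin ps

end ReLUNet

/-- First hidden layer: units `3 (j (2k+1) + a) + s` with `j < n`, `a < 2k+1`, `s < 3`; such a unit
sees the input coordinate `j` only. -/
def inputConn (k : ℕ) (u v : ℕ) : Prop := v = u / (3 * (2 * k + 1))

/-- Second hidden layer: units `j (2k+1) + a` with `j < n`, `a < 2k+1`; the unit `u` sees the three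
units `3 u`, `3 u + 1`, `3 u + 2` only. -/
def tripleConn (u v : ℕ) : Prop := v / 3 = u

/-- Third hidden layer: `(2k+1)^n` blocks of `6n` consecutive units each. The block with number
`I = ∑ j < n, i_j (2k+1)^j` (so the blocks stand for the multi-indices `(i_0, …, i_{n-1})` with
`0 ≤ i_j ≤ 2k`) sees only the `n` units `j (2k+1) + i_j`, `j < n`, of the second hidden layer. -/
def gridConn (n k : ℕ) (u v : ℕ) : Prop :=
  v % (2 * k + 1) = u / (6 * n) / (2 * k + 1) ^ (v / (2 * k + 1)) % (2 * k + 1)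

/-- A unit sees only units of its own block of `6n` consecutive units. -/
def blockConn (n : ℕ) (u v : ℕ) : Prop := v / (6 * n) = u / (6 * n)

/-- Last hidden layer: one unit for each block, which sees only that block. -/
def collectConn (n : ℕ) (u v : ℕ) : Prop := v / (6 * n) = u

/-- The hidden widths `3n(2k+1), n(2k+1), 6n(2k+1)^n, …, 6n(2k+1)^n, (2k+1)^n`, with `M` entries
equal to `6n(2k+1)^n`. -/
def hiddenWidths (n k M : ℕ) : List ℕ :=
  [3 * n * (2 * k + 1), n * (2 * k + 1)] ++ List.replicate M (6 * n * (2 * k + 1) ^ n) ++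
    [(2 * k + 1) ^ n]

/-- The local connections admitted in the hidden layers of widths `hiddenWidths n k M`, `M ≥ 1`. -/
def localConnections (n k M : ℕ) : List (ℕ → ℕ → Prop) :=
  [inputConn k, tripleConn, gridConn n k] ++ List.replicate (M - 1) (blockConn n) ++
    [collectConn n]

/-- The supremum of `|g|` over `s`. -/
noncomputable def supNormOn {α : Type*} (s : Set α) (g : α → ℝ) : ℝ :=
  sSup ((fun x => |g x|) '' s)

/-- The partial derivative of `f` with respect to the `j`-th coordinate. -/
noncomputable def partialDeriv {n : ℕ} (j : Fin n) (f : (Fin n → ℝ) → ℝ) (x : Fin n → ℝ) : ℝ :=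
  fderiv ℝ f x (Pi.single j 1)

/-!
The network computes exactly the piecewise linear interpolant of `f` at the grid points `i / 2k`,
`i ∈ {0, …, 2k}ⁿ`, on the Kuhn triangulation of the grid. Its nodal functions are
`kuhnBump (2k x - i)`, where `kuhnBump t = σ(1 - max_j σ(t_j) - max_j σ(-t_j))`.

They form a partition of unity on the cube: `kuhnBump (y - i)` is the length of the set of those
shifts `s ∈ [0, 1)` for which rounding down all coordinates of `y + (s, …, s)` gives `i`
(`kuhnBump_eq_volume`, `mem_roundingShifts_sub_iff`), and every shift rounds to exactly one grid
point (`sum_kuhnBump`). As `kuhnBump (2k x - i) ≠ 0` forces `|x_j - i_j / 2k| ≤ 1 / 2k` for all `j`,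
the value of the interpolant at `x` is an average of values of `f` at grid points at sup-distance at
most `1 / 2k` from `x`, and the mean value inequality bounds the error by
`max_j ‖∂_j f‖ · n / 2k` (`abs_sub_interpolant_le`, `abs_sub_le_of_contDiff`). The first term of the
bound would pay for an inexact multiplication of hat functions in one variable; here no
multiplication takes place.

For the network, layers 1 and 2 pass on `2k x_j`, and layer 3 computes `σ(±(2k x_j - i_j))` in the
block of the multi-index `i`. Each further layer of blocks plays one round of a knockout tournament
`w' j = max (w (2 j)) (w (2 j + 1))`, with indices modulo `n`, for each of the two families
simultaneously; a maximum of nonnegative numbers takes two units, `max a b = σ(a - b) + σ(b)`. The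
number of rounds is `(m + 5) q - 1 ≥ q ≥ log₂ n`, so both maxima are complete at the end
(`tournamentRound_iterate_eq_iSup`); surplus rounds do no harm. In one variable no
tournament is needed: `kuhnBump t = σ(1 - σ(t) - σ(-t))` is the hat function, computed from two
units.
-/

/-! ### The piecewise linear bump -/

section

open MeasureTheory

theorem relu_nonneg (x : ℝ) : 0 ≤ relu x := le_max_right _ _

theorem relu_of_nonneg {x : ℝ} (h : 0 ≤ x) : relu x = x := max_eq_left h

/-- The nodal function at the origin of the Kuhn triangulation of `ℝⁿ` with vertices in `ℤⁿ`. -/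
noncomputable def kuhnBump {n : ℕ} (t : Fin n → ℝ) : ℝ :=
  relu (1 - (⨆ j, relu (t j)) - ⨆ j, relu (-t j))

/-- The shifts `s ∈ [0, 1)` for which all coordinates of `t + (s, …, s)` lie in `[0, 1)`. -/
def roundingShifts {n : ℕ} (t : Fin n → ℝ) : Set ℝ :=
  {s | s ∈ Set.Ico (0 : ℝ) 1 ∧ ∀ j, -t j ≤ s ∧ t j + s < 1}

/-- The shifts form the interval from `max_j σ(-t_j)` to `1 - max_j σ(t_j)`. -/
theorem kuhnBump_eq_volume {n : ℕ} [NeZero n] (t : Fin n → ℝ) :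
    kuhnBump t = volume.real (roundingShifts t) := by
  have hP : ∀ j, relu (t j) ≤ ⨆ j, relu (t j) := le_ciSup (Set.finite_range _).bddAbove
  have hQ : ∀ j, relu (-t j) ≤ ⨆ j, relu (-t j) := le_ciSup (Set.finite_range _).bddAbove
  obtain ⟨p, hp⟩ := exists_eq_ciSup_of_finite (f := fun j => relu (t j))
  obtain ⟨r, hr⟩ := exists_eq_ciSup_of_finite (f := fun j => relu (-t j))
  have : roundingShifts t = Set.Ico (⨆ j, relu (-t j)) (1 - ⨆ j, relu (t j)) := by
    ext s
    simp only [roundingShifts, Set.mem_ofPred_eq, Set.mem_Ico]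
    constructor
    · rintro ⟨⟨h0, h1⟩, h⟩
      rw [← hp, ← hr]
      refine ⟨max_le (h r).1 h0, ?_⟩
      have : relu (t p) < 1 - s := max_lt (by linarith [(h p).2]) (by linarith)
      linarith
    · rintro ⟨h0, h1⟩
      have hs0 := relu_nonneg (-t r)
      have hs1 := relu_nonneg (t p)
      refine ⟨⟨by linarith, by linarith⟩, fun j => ⟨?_, ?_⟩⟩
      · exact ((le_max_left _ _).trans (hQ j)).trans h0
      · linarith [(le_max_left (t j) 0).trans (hP j)]
  rw [this, Real.volume_real_Ico, kuhnBump, relu]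

theorem measurableSet_roundingShifts {n : ℕ} (t : Fin n → ℝ) :
    MeasurableSet (roundingShifts t) := by
  simp only [roundingShifts, Set.ofPred_and, Set.ofPred_forall, Set.ofPred_mem_eq]
  refine measurableSet_Ico.inter (MeasurableSet.iInter fun j => ?_)
  exact (measurableSet_le (by fun_prop) (by fun_prop)).inter
    (measurableSet_lt (by fun_prop) (by fun_prop))

theorem volume_roundingShifts_ne_top {n : ℕ} (t : Fin n → ℝ) : volume (roundingShifts t) ≠ ⊤ :=
  ((measure_mono fun _ hs => hs.1).trans_lt (measure_Ico_lt_top (a := (0 : ℝ)) (b := 1))).ne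

theorem mem_roundingShifts_sub_iff {n : ℕ} {y : Fin n → ℝ} (hy : ∀ j, 0 ≤ y j) (i : Fin n → ℕ)
    {s : ℝ} : s ∈ roundingShifts (fun j => y j - i j) ↔
      s ∈ Set.Ico (0 : ℝ) 1 ∧ ∀ j, ⌊y j + s⌋₊ = i j := by
  refine and_congr_right fun hs => forall_congr' fun j => ?_
  rw [Nat.floor_eq_iff (add_nonneg (hy j) hs.1)]
  constructor <;> rintro ⟨h1, h2⟩ <;> constructor <;> linarith

/-- The sets of shifts that round `y` to the various grid points partition `[0, 1)`. -/
theorem sum_kuhnBump {n : ℕ} [NeZero n] (k : ℕ) (y : Fin n → ℝ)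
    (hy : ∀ j, 0 ≤ y j ∧ y j ≤ 2 * k) :
    ∑ i : Fin n → Fin (2 * k + 1), kuhnBump (fun j => y j - (i j : ℕ)) = 1 := by
  have hmem : ∀ (i : Fin n → Fin (2 * k + 1)) (s : ℝ),
      s ∈ roundingShifts (fun j => y j - (i j : ℕ)) ↔
        s ∈ Set.Ico (0 : ℝ) 1 ∧ ∀ j, ⌊y j + s⌋₊ = (i j : ℕ) := fun i s =>
    mem_roundingShifts_sub_iff (fun j => (hy j).1) fun j => (i j : ℕ)
  have hdisj : Pairwise (Function.onFun Disjoint fun i : Fin n → Fin (2 * k + 1) =>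
      roundingShifts (fun j => y j - (i j : ℕ))) := by
    intro i i' hne
    refine Set.disjoint_left.2 fun s hs hs' => hne (funext fun j => Fin.ext ?_)
    exact (((hmem i s).1 hs).2 j).symm.trans (((hmem i' s).1 hs').2 j)
  have hunion : ⋃ i : Fin n → Fin (2 * k + 1), roundingShifts (fun j => y j - (i j : ℕ)) =
      Set.Ico 0 1 := by
    ext s
    rw [Set.mem_iUnion]
    refine ⟨fun ⟨i, hi⟩ => hi.1, fun hs => ?_⟩
    have hlt : ∀ j, ⌊y j + s⌋₊ < 2 * k + 1 := fun j => by
      rw [Nat.floor_lt (add_nonneg (hy j).1 hs.1)]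
      push_cast
      linarith [(hy j).2, hs.2]
    exact ⟨fun j => ⟨_, hlt j⟩, (hmem _ s).2 ⟨hs, fun j => rfl⟩⟩
  simp only [kuhnBump_eq_volume]
  rw [← measureReal_iUnion_fintype hdisj (fun i => measurableSet_roundingShifts _)
    (fun i => volume_roundingShifts_ne_top _), hunion, Real.volume_real_Ico]
  norm_num

theorem abs_le_one_of_kuhnBump_ne_zero {n : ℕ} {t : Fin n → ℝ} (h : kuhnBump t ≠ 0) (j : Fin n) :
    |t j| ≤ 1 := by
  have hP : relu (t j) ≤ ⨆ j, relu (t j) := le_ciSup (f := fun j => relu (t j))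
    (Set.finite_range _).bddAbove j
  have hQ : relu (-t j) ≤ ⨆ j, relu (-t j) := le_ciSup (f := fun j => relu (-t j))
    (Set.finite_range _).bddAbove j
  have h1 : 0 < 1 - (⨆ j, relu (t j)) - ⨆ j, relu (-t j) := by
    by_contra hc
    exact h (max_eq_right (not_lt.1 hc))
  have := relu_nonneg (t j)
  have := relu_nonneg (-t j)
  have : t j ≤ relu (t j) := le_max_left _ _
  have : -t j ≤ relu (-t j) := le_max_left _ _
  exact abs_le.2 ⟨by linarith, by linarith⟩

/-- The interpolant is an average of the values of `f` at grid points near `x`. -/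
theorem abs_sub_interpolant_le {n : ℕ} [NeZero n] {k : ℕ} (hk : 0 < k) {f : (Fin n → ℝ) → ℝ}
    {x : Fin n → ℝ} (hx : x ∈ Set.Icc (0 : Fin n → ℝ) 1) {E : ℝ}
    (hE : ∀ z ∈ Set.Icc (0 : Fin n → ℝ) 1, (∀ j, |x j - z j| ≤ 1 / (2 * k)) → |f x - f z| ≤ E) :
    |f x - ∑ i : Fin n → Fin (2 * k + 1),
      f (fun j => (i j : ℕ) / (2 * k)) * kuhnBump (fun j => 2 * k * x j - (i j : ℕ))| ≤ E := by
  have hk' : (0 : ℝ) < 2 * k := by positivity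
  have hsum := sum_kuhnBump k (fun j => 2 * k * x j) fun j =>
    ⟨mul_nonneg hk'.le (hx.1 j), mul_le_of_le_one_right hk'.le (hx.2 j)⟩
  have hterm : ∀ i : Fin n → Fin (2 * k + 1),
      |(f x - f (fun j => (i j : ℕ) / (2 * k))) * kuhnBump (fun j => 2 * k * x j - (i j : ℕ))| ≤
        E * kuhnBump (fun j => 2 * k * x j - (i j : ℕ)) := by
    intro i
    have h0 : 0 ≤ kuhnBump (fun j => 2 * k * x j - (i j : ℕ)) := relu_nonneg _
    rw [abs_mul, abs_of_nonneg h0]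
    by_cases h : kuhnBump (fun j => 2 * k * x j - (i j : ℕ)) = 0
    · simp [h]
    refine mul_le_mul_of_nonneg_right (hE _ ⟨fun j => ?_, fun j => ?_⟩ fun j => ?_) h0
    · simp only [Pi.zero_apply]; positivity
    · simp only [Pi.one_apply]
      rw [div_le_one hk']
      have : (i j : ℕ) ≤ 2 * k := Nat.lt_succ_iff.1 (i j).2
      exact_mod_cast this
    · have := abs_le_one_of_kuhnBump_ne_zero h j
      rw [show x j - (i j : ℕ) / (2 * k : ℝ) = (2 * k * x j - (i j : ℕ)) / (2 * k) by
        field_simp, abs_div, abs_of_pos hk']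
      gcongr
  calc _ = |∑ i : Fin n → Fin (2 * k + 1), (f x - f (fun j => (i j : ℕ) / (2 * k))) *
          kuhnBump (fun j => 2 * k * x j - (i j : ℕ))| := by
        simp only [sub_mul, Finset.sum_sub_distrib]
        rw [← Finset.mul_sum, hsum, mul_one]
    _ ≤ ∑ i : Fin n → Fin (2 * k + 1), E * kuhnBump (fun j => 2 * k * x j - (i j : ℕ)) :=
        (Finset.abs_sum_le_sum_abs _ _).trans (Finset.sum_le_sum fun i _ => hterm i)
    _ = E := by rw [← Finset.mul_sum, hsum, mul_one]

end

/-! ### Lipschitz bounds on the unit cube -/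

theorem le_supNormOn {α : Type*} [TopologicalSpace α] {s : Set α} (hs : IsCompact s) {g : α → ℝ}
    (hg : Continuous g) {x : α} (hx : x ∈ s) : |g x| ≤ supNormOn s g :=
  le_csSup (hs.image hg.abs).bddAbove ⟨x, hx, rfl⟩

theorem supNormOn_nonneg {α : Type*} (s : Set α) (g : α → ℝ) : 0 ≤ supNormOn s g :=
  Real.sSup_nonneg (by rintro _ ⟨x, -, rfl⟩; exact abs_nonneg _)

theorem norm_le_of_forall_apply_single_le {n : ℕ} (A : (Fin n → ℝ) →L[ℝ] ℝ) {D : ℝ}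
    (hA : ∀ j, |A (Pi.single j 1)| ≤ D) (hD : 0 ≤ D) : ‖A‖ ≤ n * D := by
  refine A.opNorm_le_bound (by positivity) fun v => ?_
  have hv : A v = ∑ j, v j * A (Pi.single j 1) := by
    conv_lhs => rw [pi_eq_sum_univ' v]
    simp [map_sum]
  rw [hv]
  calc ‖∑ j, v j * A (Pi.single j 1)‖ ≤ ∑ j : Fin n, ‖v‖ * D := by
        refine (norm_sum_le _ _).trans (Finset.sum_le_sum fun j _ => ?_)
        rw [norm_mul]
        exact mul_le_mul (norm_le_pi_norm v j) (hA j) (norm_nonneg _) (norm_nonneg _)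
    _ = n * D * ‖v‖ := by simp; ring

theorem abs_sub_le_of_contDiff {n : ℕ} {f : (Fin n → ℝ) → ℝ} (hf : ContDiff ℝ 1 f)
    {x z : Fin n → ℝ} (hx : x ∈ Set.Icc (0 : Fin n → ℝ) 1) (hz : z ∈ Set.Icc (0 : Fin n → ℝ) 1)
    {δ : ℝ} (hδ : 0 ≤ δ) (h : ∀ j, |x j - z j| ≤ δ) :
    |f x - f z| ≤
      (⨆ j : Fin n, supNormOn (Set.Icc (0 : Fin n → ℝ) 1) (partialDeriv j f)) * n * δ := by
  set D := ⨆ j : Fin n, supNormOn (Set.Icc (0 : Fin n → ℝ) 1) (partialDeriv j f)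
  have hD : 0 ≤ D := Real.iSup_nonneg fun j => supNormOn_nonneg _ _
  have hbound : ∀ w ∈ Set.Icc (0 : Fin n → ℝ) 1, ‖fderiv ℝ f w‖ ≤ n * D := fun w hw =>
    norm_le_of_forall_apply_single_le _ (fun j =>
      (le_supNormOn (g := partialDeriv j f) isCompact_Icc
        ((hf.continuous_fderiv one_ne_zero).clm_apply continuous_const) hw).trans
      (le_ciSup (f := fun j => supNormOn (Set.Icc (0 : Fin n → ℝ) 1) (partialDeriv j f))
        (Set.finite_range _).bddAbove j)) hD
  have := (convex_Icc (0 : Fin n → ℝ) 1).norm_image_sub_le_of_norm_fderiv_le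
    (fun w _ => (hf.differentiable one_ne_zero) w) hbound hz hx
  rw [mul_comm D]
  refine this.trans (mul_le_mul_of_nonneg_left ?_ (by positivity))
  exact (pi_norm_le_iff_of_nonneg hδ).2 h

/-! ### Maxima by a tournament -/

/-- One round of a knockout tournament: the entries are compared in adjacent pairs, and the maximum
of the `j`-th pair becomes the `j`-th entry. -/
noncomputable def tournamentRound (w : ℕ → ℝ) (j : ℕ) : ℝ := max (w (2 * j)) (w (2 * j + 1))

theorem le_tournamentRound_iterate (T : ℕ) (w : ℕ → ℝ) (j : ℕ) {i : ℕ} (hi : i < 2 ^ T) :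
    w (2 ^ T * j + i) ≤ tournamentRound^[T] w j := by
  induction T generalizing w i with
  | zero => simp_all
  | succ T ih =>
    rw [Function.iterate_succ_apply]
    have h2 : i / 2 < 2 ^ T := by rw [pow_succ] at hi; omega
    refine le_trans ?_ (ih (tournamentRound w) h2)
    have h3 : 2 ^ (T + 1) * j + i = 2 * (2 ^ T * j + i / 2) + i % 2 := by
      have := Nat.div_add_mod i 2
      rw [pow_succ]; nlinarith
    rw [h3, tournamentRound]
    rcases Nat.mod_two_eq_zero_or_one i with h | h <;> rw [h]
    · exact le_max_left _ _
    · exact le_max_right _ _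

theorem exists_tournamentRound_iterate_eq (T : ℕ) (w : ℕ → ℝ) (j : ℕ) :
    ∃ i, tournamentRound^[T] w j = w i := by
  induction T generalizing w with
  | zero => exact ⟨j, rfl⟩
  | succ T ih =>
    rw [Function.iterate_succ_apply]
    obtain ⟨i, hi⟩ := ih (tournamentRound w)
    rw [hi, tournamentRound]
    rcases max_choice (w (2 * i)) (w (2 * i + 1)) with h | h
    · exact ⟨_, h⟩
    · exact ⟨_, h⟩

/-- After `T` rounds the entry `0` is the maximum of the first `2 ^ T` entries. As the `n` numbers are
repeated periodically, only `n ≤ 2 ^ T` matters. -/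
theorem tournamentRound_iterate_eq_iSup {n T : ℕ} [NeZero n] (hT : n ≤ 2 ^ T) (w : ℕ → ℝ) :
    tournamentRound^[T] (fun j => w (j % n)) 0 = ⨆ j : Fin n, w j := by
  have hb : BddAbove (Set.range fun j : Fin n => w j) := (Set.finite_range _).bddAbove
  apply le_antisymm
  · obtain ⟨i, hi⟩ := exists_tournamentRound_iterate_eq T (fun j => w (j % n)) 0
    rw [hi]
    exact le_ciSup hb (⟨i % n, Nat.mod_lt _ (NeZero.pos n)⟩ : Fin n)
  · refine ciSup_le fun j => ?_
    have := le_tournamentRound_iterate T (fun j => w (j % n)) 0 (j.2.trans_le hT)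
    simpa [Nat.mod_eq_of_lt j.2] using this

/-! ### Sparse layers -/

/-- The weight row that reads unit number `i` of the preceding layer. -/
noncomputable def pick (i v : ℕ) : ℝ := if v = i then 1 else 0

/-- The value of unit number `i`, and `0` if there is no such unit. -/
noncomputable def entry {a : ℕ} (x : Fin a → ℝ) (i : ℕ) : ℝ := if h : i < a then x ⟨i, h⟩ else 0

theorem pick_ne_zero {i v : ℕ} : pick i v ≠ 0 ↔ v = i := by simp [pick]

theorem entry_of_lt {a : ℕ} (x : Fin a → ℝ) {i : ℕ} (h : i < a) : entry x i = x ⟨i, h⟩ := dif_pos h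

theorem sum_pick_mul {a : ℕ} (x : Fin a → ℝ) (i : ℕ) :
    ∑ v : Fin a, pick i v * x v = entry x i := by
  unfold entry pick
  split_ifs with h
  · rw [Finset.sum_eq_single ⟨i, h⟩]
    · simp
    · intro b _ hb
      have : (b : ℕ) ≠ i := fun hc => hb (Fin.ext hc)
      simp [this]
    · simp
  · refine Finset.sum_eq_zero fun v _ => ?_
    have : (v : ℕ) ≠ i := fun hc => h (hc ▸ v.2)
    simp [this]

/-! ### The blocks -/

/-- The number of the unit `6 j + 3 g + r` of block `I`. The numbers `j < n`, `g < 2`, `r < 3` are the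
position in the tournament, the tournament (`0` for `σ(t_j)`, `1` for `σ(-t_j)`), and the summand of
the value at this position; the value is the sum of the units `r = 0` and `r = 1`, and the unit
`r = 2` is never read. -/
def slot (n I j g r : ℕ) : ℕ := 6 * n * I + (6 * j + 3 * g + r)

section

variable {n I j g r : ℕ}

theorem local_lt (hj : j < n) (hg : g < 2) (hr : r < 3) : 6 * j + 3 * g + r < 6 * n := by omega

theorem slot_div (hj : j < n) (hg : g < 2) (hr : r < 3) : slot n I j g r / (6 * n) = I := by
  have h := local_lt hj hg hr
  rw [slot, Nat.mul_add_div (by omega), Nat.div_eq_of_lt h, add_zero]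

theorem slot_mod (hj : j < n) (hg : g < 2) (hr : r < 3) :
    slot n I j g r % (6 * n) = 6 * j + 3 * g + r := by
  rw [slot, Nat.mul_add_mod, Nat.mod_eq_of_lt (local_lt hj hg hr)]

theorem slot_lt {p : ℕ} (hI : I < p) (hj : j < n) (hg : g < 2) (hr : r < 3) :
    slot n I j g r < 6 * n * p := by
  have h := local_lt hj hg hr
  have := Nat.mul_le_mul_left (6 * n) (Nat.succ_le_of_lt hI)
  rw [slot]
  rw [Nat.mul_succ] at this
  omega

end

/-- The coordinate `I` of `u = slot n I j g r`. -/
def unitBlock (n u : ℕ) : ℕ := u / (6 * n)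

/-- The coordinate `j` of `u = slot n I j g r`. -/
def unitIndex (n u : ℕ) : ℕ := u % (6 * n) / 6

/-- The coordinate `g` of `u = slot n I j g r`. -/
def unitSide (n u : ℕ) : ℕ := u % (6 * n) % 6 / 3

/-- The coordinate `r` of `u = slot n I j g r`. -/
def unitTerm (n u : ℕ) : ℕ := u % (6 * n) % 3

section

variable {n I j g r : ℕ}

theorem unitBlock_slot (hj : j < n) (hg : g < 2) (hr : r < 3) :
    unitBlock n (slot n I j g r) = I := slot_div hj hg hr

theorem unitIndex_slot (hj : j < n) (hg : g < 2) (hr : r < 3) :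
    unitIndex n (slot n I j g r) = j := by
  rw [unitIndex, slot_mod hj hg hr]; omega

theorem unitSide_slot (hj : j < n) (hg : g < 2) (hr : r < 3) :
    unitSide n (slot n I j g r) = g := by
  rw [unitSide, slot_mod hj hg hr]; omega

theorem unitTerm_slot (hj : j < n) (hg : g < 2) (hr : r < 3) :
    unitTerm n (slot n I j g r) = r := by
  rw [unitTerm, slot_mod hj hg hr]; omega

end

theorem unitSide_lt (n u : ℕ) : unitSide n u < 2 := by unfold unitSide; omega

/-- The entry at position `j`, taken modulo `n`, of the tournament `g` in block `I`. -/
noncomputable def slotValue {a : ℕ} (n : ℕ) (x : Fin a → ℝ) (I g j : ℕ) : ℝ :=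
  entry x (slot n I (j % n) g 0) + entry x (slot n I (j % n) g 1)

/-- The weight row that reads `slotValue n x I g j`. -/
noncomputable def slotPick (n I g j v : ℕ) : ℝ :=
  pick (slot n I (j % n) g 0) v + pick (slot n I (j % n) g 1) v

theorem sum_slotPick_mul {a : ℕ} (x : Fin a → ℝ) (n I g j : ℕ) :
    ∑ v : Fin a, slotPick n I g j v * x v = slotValue n x I g j := by
  simp only [slotPick, add_mul, Finset.sum_add_distrib, sum_pick_mul, slotValue]

theorem div_eq_of_slotPick_ne_zero {n I g j v : ℕ} (hn : 0 < n) (hg : g < 2)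
    (h : slotPick n I g j v ≠ 0) : v / (6 * n) = I := by
  have hj := Nat.mod_lt j hn
  by_cases h0 : v = slot n I (j % n) g 0
  · rw [h0, slot_div hj hg (by omega)]
  by_cases h1 : v = slot n I (j % n) g 1
  · rw [h1, slot_div hj hg (by omega)]
  · simp [slotPick, pick, h0, h1] at h

/-- Weights that turn entries `w` into the summands `σ(w (2 j) - w (2 j + 1))` and `σ(w (2 j + 1))` of
their maximum. -/
noncomputable def roundWeight (n u v : ℕ) : ℝ :=
  if unitTerm n u = 0 then
    slotPick n (unitBlock n u) (unitSide n u) (2 * unitIndex n u) v -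
      slotPick n (unitBlock n u) (unitSide n u) (2 * unitIndex n u + 1) v
  else slotPick n (unitBlock n u) (unitSide n u) (2 * unitIndex n u + 1) v

/-- Weights that, with bias `1`, turn the maxima `P`, `Q` of a block into `1 - P - Q`. -/
noncomputable def collectWeight (n u v : ℕ) : ℝ := -(slotPick n u 0 0 v + slotPick n u 1 0 v)

/-- `T` rounds in every block, followed by the layer that collects the blocks and by the output with
coefficients `C`. -/
noncomputable def tournamentNet (n p : ℕ) (C : Fin p → ℝ) :
    (T : ℕ) → ReLUNet (6 * n * p) (List.replicate T (6 * n * p) ++ [p]) 1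
  | 0 => .hidden (fun u v => collectWeight n u v) (fun _ => 1) (.output (fun _ v => C v) 0)
  | T + 1 => .hidden (fun u v => roundWeight n u v) 0 (tournamentNet n p C T)

theorem tournamentNet_connectedWithin {n : ℕ} (hn : 0 < n) (p : ℕ) (C : Fin p → ℝ) (T : ℕ) :
    (tournamentNet n p C T).ConnectedWithin
      (List.replicate T (blockConn n) ++ [collectConn n]) := by
  induction T with
  | zero =>
    refine ⟨fun u v h => ?_, trivial⟩
    by_cases h0 : slotPick n u 0 0 v = 0
    · by_cases h1 : slotPick n u 1 0 v = 0
      · simp [collectWeight, h0, h1] at h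
      · exact div_eq_of_slotPick_ne_zero hn (by omega) h1
    · exact div_eq_of_slotPick_ne_zero hn (by omega) h0
  | succ T ih =>
    refine ⟨fun u v h => ?_, ih⟩
    have hs := unitSide_lt n u
    by_cases h0 : slotPick n (unitBlock n u) (unitSide n u) (2 * unitIndex n u) v = 0
    · by_cases h1 : slotPick n (unitBlock n u) (unitSide n u) (2 * unitIndex n u + 1) v = 0
      · simp [roundWeight, h0, h1] at h
      · exact div_eq_of_slotPick_ne_zero hn hs h1
    · exact div_eq_of_slotPick_ne_zero hn hs h0

theorem entry_nonneg {a : ℕ} {x : Fin a → ℝ} (hx : ∀ i, 0 ≤ x i) (i : ℕ) : 0 ≤ entry x i := by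
  unfold entry; split_ifs <;> simp [hx]

theorem relu_sub_add_relu {a b : ℝ} (hb : 0 ≤ b) : relu (a - b) + relu b = max a b := by
  rw [relu, relu, max_eq_left hb, max_add_add_right _ _ _ |>.symm]
  simp

/-- A layer with weights `roundWeight` plays one round in every block. Taking positions modulo `n` is
compatible with this, as `2 j` and `2 j + 1` modulo `n` depend only on `j` modulo `n`. -/
theorem slotValue_round {n p I g : ℕ} (hn : 0 < n) (hI : I < p) (hg : g < 2)
    {x : Fin (6 * n * p) → ℝ} (hx : ∀ i, 0 ≤ x i) :
    slotValue n (fun u : Fin (6 * n * p) =>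
        relu ((∑ v : Fin (6 * n * p), roundWeight n u v * x v) + (0 : Fin (6 * n * p) → ℝ) u)) I g =
      tournamentRound (slotValue n x I g) := by
  funext j
  have hj := Nat.mod_lt j hn
  have hmod0 : 2 * (j % n) % n = 2 * j % n := by simp [Nat.mul_mod]
  have hmod1 : (2 * (j % n) + 1) % n = (2 * j + 1) % n := by
    rw [Nat.add_mod, hmod0, ← Nat.add_mod]
  have hv0 : slotValue n x I g (2 * (j % n)) = slotValue n x I g (2 * j) := by
    rw [slotValue, slotValue, hmod0]
  have hv1 : slotValue n x I g (2 * (j % n) + 1) = slotValue n x I g (2 * j + 1) := by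
    rw [slotValue, slotValue, hmod1]
  rw [slotValue, entry_of_lt _ (slot_lt hI hj hg (by omega)),
    entry_of_lt _ (slot_lt hI hj hg (by omega))]
  have h0 := @unitTerm_slot n I (j % n) g 0 hj hg (by omega)
  have h1 := @unitTerm_slot n I (j % n) g 1 hj hg (by omega)
  simp only [roundWeight, h0, h1, @unitBlock_slot n I (j % n) g 0 hj hg (by omega),
    @unitBlock_slot n I (j % n) g 1 hj hg (by omega),
    @unitSide_slot n I (j % n) g 0 hj hg (by omega),
    @unitSide_slot n I (j % n) g 1 hj hg (by omega),
    @unitIndex_slot n I (j % n) g 0 hj hg (by omega),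
    @unitIndex_slot n I (j % n) g 1 hj hg (by omega), if_true, one_ne_zero, if_false,
    Pi.zero_apply, add_zero, sub_mul, Finset.sum_sub_distrib, sum_slotPick_mul, hv0, hv1]
  exact relu_sub_add_relu (add_nonneg (entry_nonneg hx _) (entry_nonneg hx _))

theorem tournamentNet_eval {n : ℕ} (hn : 0 < n) (p : ℕ) (C : Fin p → ℝ) (T : ℕ)
    {x : Fin (6 * n * p) → ℝ} (hx : ∀ i, 0 ≤ x i) :
    (tournamentNet n p C T).eval x 0 = ∑ I : Fin p, C I *
      relu (1 - tournamentRound^[T] (slotValue n x I 0) 0 -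
        tournamentRound^[T] (slotValue n x I 1) 0) := by
  induction T generalizing x with
  | zero =>
    simp only [tournamentNet, ReLUNet.eval, collectWeight, neg_mul, add_mul,
      Finset.sum_neg_distrib, Finset.sum_add_distrib, sum_slotPick_mul, Pi.zero_apply, add_zero,
      Function.iterate_zero, id_eq]
    refine Finset.sum_congr rfl fun I _ => ?_
    congr 2
    ring
  | succ T ih =>
    refine (ih (x := fun u => relu ((∑ v : Fin (6 * n * p), roundWeight n u v * x v) +
      (0 : Fin (6 * n * p) → ℝ) u)) fun i => relu_nonneg _).trans (Finset.sum_congr rfl fun I _ => ?_)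
    rw [Function.iterate_succ_apply, Function.iterate_succ_apply,
      slotValue_round hn I.2 (by omega) hx, slotValue_round hn I.2 (by omega) hx]

/-! ### The interpolating network -/

/-- Weights by which each of the `3 (2k+1)` units of the `j`-th group computes `2k x_j`. -/
noncomputable def inputWeight (k u v : ℕ) : ℝ := 2 * k * pick (u / (3 * (2 * k + 1))) v

/-- Weights that copy the first unit of each triple. -/
noncomputable def tripleWeight (u v : ℕ) : ℝ := pick (3 * u) v

/-- The component `i_j` of the multi-index `i` of the block of `u = slot n I j g r`, that is, the digit
of `I` in base `2k+1` at the place `(2k+1) ^ j`. -/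
def unitDigit (n k u : ℕ) : ℕ :=
  unitBlock n u / (2 * k + 1) ^ unitIndex n u % (2 * k + 1)

/-- The sign with which `t_j` enters the unit `u = slot n I j g r` of the third layer. It is `0` for
`r ≠ 0`: initially the value at each position has a single nonzero summand. -/
noncomputable def unitSign (n u : ℕ) : ℝ :=
  if unitTerm n u = 0 then (if unitSide n u = 0 then 1 else -1) else 0

/-- Weights that, with biases `-(unitSign n u * unitDigit n k u)`, turn the inputs `2k x_j` into
`±(2k x_j - i_j)`. -/
noncomputable def gridWeight (n k u v : ℕ) : ℝ :=
  unitSign n u * pick (unitIndex n u * (2 * k + 1) + unitDigit n k u) v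

/-- The network whose output is `∑ i, C i * kuhnBump (2k x - i)` for `x` in the positive orthant, if
`n ≤ 2 ^ T`. Blocks are numbered by `finFunctionFinEquiv`. -/
noncomputable def interpolationNet (n k T : ℕ) (C : Fin ((2 * k + 1) ^ n) → ℝ) :
    ReLUNet n (hiddenWidths n k (T + 1)) 1 :=
  .hidden (fun u v => inputWeight k u v) 0 <|
  .hidden (fun u v => tripleWeight u v) 0 <|
  .hidden (fun u v => gridWeight n k u v) (fun u => -(unitSign n u * unitDigit n k u)) <|
  tournamentNet n ((2 * k + 1) ^ n) C T

theorem interpolationNet_connectedWithin {n : ℕ} (hn : 0 < n) (k T : ℕ)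
    (C : Fin ((2 * k + 1) ^ n) → ℝ) :
    (interpolationNet n k T C).ConnectedWithin (localConnections n k (T + 1)) := by
  refine ⟨fun u v h => ?_, fun u v h => ?_, fun u v h => ?_,
    tournamentNet_connectedWithin hn _ C T⟩
  · exact pick_ne_zero.1 (right_ne_zero_of_mul h)
  · have := pick_ne_zero.1 h
    rw [tripleConn]; omega
  · have hv := pick_ne_zero.1 (right_ne_zero_of_mul h)
    have hd : unitDigit n k u < 2 * k + 1 := Nat.mod_lt _ (by omega)
    have h1 : (v : ℕ) % (2 * k + 1) = unitDigit n k u := by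
      rw [hv, Nat.mul_add_mod', Nat.mod_eq_of_lt hd]
    have h2 : (v : ℕ) / (2 * k + 1) = unitIndex n u := by
      rw [hv, mul_comm, Nat.mul_add_div (by omega), Nat.div_eq_of_lt hd, add_zero]
    rw [gridConn, h1, h2]
    rfl

theorem interpolationNet_eval {n k T : ℕ} [NeZero n] (hT : n ≤ 2 ^ T)
    (C : Fin ((2 * k + 1) ^ n) → ℝ) {x : Fin n → ℝ} (hx : ∀ j, 0 ≤ x j) :
    (interpolationNet n k T C).eval x 0 = ∑ i : Fin n → Fin (2 * k + 1),
      C (finFunctionFinEquiv i) * kuhnBump (fun j => 2 * k * x j - (i j : ℕ)) := by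
  have hn := NeZero.pos n
  set z₁ : Fin (3 * n * (2 * k + 1)) → ℝ := fun u => relu ((∑ v : Fin n, inputWeight k u v * x v) +
    (0 : Fin (3 * n * (2 * k + 1)) → ℝ) u) with hz₁
  set z₂ : Fin (n * (2 * k + 1)) → ℝ := fun u =>
    relu ((∑ v : Fin (3 * n * (2 * k + 1)), tripleWeight u v * z₁ v) +
    (0 : Fin (n * (2 * k + 1)) → ℝ) u) with hz₂
  set z₃ : Fin (6 * n * (2 * k + 1) ^ n) → ℝ := fun u =>
    relu ((∑ v : Fin (n * (2 * k + 1)), gridWeight n k u v * z₂ v) +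
    -(unitSign n u * unitDigit n k u)) with hz₃
  have heval : (interpolationNet n k T C).eval x 0 =
    (tournamentNet n ((2 * k + 1) ^ n) C T).eval z₃ 0 := rfl
  have h₁ : ∀ (j : Fin n) (r : ℕ), r < 3 * (2 * k + 1) →
      entry z₁ (3 * (2 * k + 1) * j + r) = 2 * k * x j := by
    intro j r hr
    have hlt : 3 * (2 * k + 1) * j + r < 3 * n * (2 * k + 1) := by
      have := Nat.mul_le_mul_left (3 * (2 * k + 1)) (Nat.succ_le_of_lt j.2)
      rw [Nat.mul_succ] at this
      calc _ < 3 * (2 * k + 1) * n := by omega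
        _ = _ := by ring
    have hdiv : (3 * (2 * k + 1) * j + r) / (3 * (2 * k + 1)) = j := by
      rw [Nat.mul_add_div (by omega), Nat.div_eq_of_lt hr, add_zero]
    rw [entry_of_lt _ hlt]
    simp only [hz₁, inputWeight, mul_assoc, ← Finset.mul_sum, sum_pick_mul, Pi.zero_apply, add_zero]
    rw [← mul_assoc 3, hdiv, entry_of_lt _ j.2, relu_of_nonneg]
    have := hx j
    positivity
  have h₂ : ∀ (j : Fin n) (d : ℕ), d < 2 * k + 1 →
      entry z₂ (j * (2 * k + 1) + d) = 2 * k * x j := by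
    intro j d hd
    have hlt : j * (2 * k + 1) + d < n * (2 * k + 1) := by
      have := Nat.mul_le_mul_right (2 * k + 1) (Nat.succ_le_of_lt j.2)
      rw [Nat.succ_mul] at this
      omega
    rw [entry_of_lt _ hlt]
    simp only [hz₂, tripleWeight, sum_pick_mul, Pi.zero_apply, add_zero]
    rw [show 3 * ((j : ℕ) * (2 * k + 1) + d) = 3 * (2 * k + 1) * j + 3 * d by ring,
      h₁ j _ (by omega), relu_of_nonneg]
    have := hx j
    positivity
  have h₃ : ∀ (I : Fin ((2 * k + 1) ^ n)) (j : Fin n) (g : ℕ), g < 2 →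
      entry z₃ (slot n I j g 0) + entry z₃ (slot n I j g 1) =
        relu ((if g = 0 then 1 else -1) *
          (2 * k * x j - ((finFunctionFinEquiv.symm I j : Fin (2 * k + 1)) : ℕ))) := by
    intro I j g hg
    have hdig : ((finFunctionFinEquiv.symm I j : Fin (2 * k + 1)) : ℕ) =
      I / (2 * k + 1) ^ (j : ℕ) % (2 * k + 1) := rfl
    rw [entry_of_lt _ (slot_lt I.2 j.2 hg (by omega)),
      entry_of_lt _ (slot_lt I.2 j.2 hg (by omega)), hdig]
    have hd : (I : ℕ) / (2 * k + 1) ^ (j : ℕ) % (2 * k + 1) < 2 * k + 1 := Nat.mod_lt _ (by omega)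
    simp only [hz₃, gridWeight, unitSign, unitDigit, mul_assoc, ← Finset.mul_sum, sum_pick_mul,
      @unitTerm_slot n I j g 0 j.2 hg (by omega), @unitTerm_slot n I j g 1 j.2 hg (by omega),
      @unitBlock_slot n I j g 0 j.2 hg (by omega), @unitSide_slot n I j g 0 j.2 hg (by omega),
      @unitIndex_slot n I j g 0 j.2 hg (by omega), if_true, one_ne_zero, if_false, h₂ j _ hd]
    rw [zero_mul, zero_mul, neg_zero, add_zero, relu_of_nonneg le_rfl, add_zero]
    congr 1
    ring
  have hz₃_nonneg : ∀ u, 0 ≤ z₃ u := fun u => relu_nonneg _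
  clear_value z₃
  have h₄ : ∀ (I : Fin ((2 * k + 1) ^ n)) (g : ℕ),
      tournamentRound^[T] (slotValue n z₃ I g) 0 =
        ⨆ j : Fin n, (entry z₃ (slot n I j g 0) + entry z₃ (slot n I j g 1)) := fun I g =>
    tournamentRound_iterate_eq_iSup hT
      (fun j => entry z₃ (slot n I j g 0) + entry z₃ (slot n I j g 1))
  rw [heval, tournamentNet_eval hn _ C T hz₃_nonneg,
    ← Equiv.sum_comp (finFunctionFinEquiv (m := 2 * k + 1) (n := n))]
  refine Finset.sum_congr rfl fun i _ => ?_
  simp only [h₄, h₃ _ _ 0 (by omega), h₃ _ _ 1 (by omega), Equiv.symm_apply_apply, kuhnBump,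
    if_true, one_ne_zero, if_false, one_mul, neg_one_mul]

/-! ### One variable -/

/-- The network in one variable whose output is `∑ i, C i * σ(1 - |2k x - i|)`. In the triple of `i` the
units compute `σ(2k x - i)`, `σ(i - 2k x)` and `0`. -/
noncomputable def tentNet (k : ℕ) (C : Fin (2 * k + 1) → ℝ) :
    ReLUNet 1 [3 * (2 * k + 1), 2 * k + 1] 1 :=
  .hidden (fun u _ => if (u : ℕ) % 3 = 0 then 2 * k else if (u : ℕ) % 3 = 1 then -(2 * k) else 0)
    (fun u => if (u : ℕ) % 3 = 0 then -((u / 3 : ℕ) : ℝ) else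
      if (u : ℕ) % 3 = 1 then ((u / 3 : ℕ) : ℝ) else 0) <|
  .hidden (fun u v => -(pick (3 * u) v + pick (3 * u + 1) v)) (fun _ => 1) <|
  .output (fun _ v => C v) 0

theorem tentNet_connectedWithin (k : ℕ) (C : Fin (2 * k + 1) → ℝ) :
    (tentNet k C).ConnectedWithin [inputConn k, tripleConn] := by
  refine ⟨fun u v _ => ?_, fun u v h => ?_, trivial⟩
  · rw [inputConn, Nat.div_eq_of_lt u.2]
    omega
  · rw [tripleConn]
    by_cases h0 : (v : ℕ) = 3 * u
    · omega
    by_cases h1 : (v : ℕ) = 3 * u + 1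
    · omega
    · simp [pick, h0, h1] at h

theorem tentNet_eval (k : ℕ) (C : Fin (2 * k + 1) → ℝ) (x : ℝ) :
    (tentNet k C).eval (fun _ => x) 0 = ∑ i : Fin 1 → Fin (2 * k + 1),
      C (i 0) * kuhnBump (fun j => 2 * k * x - (i j : ℕ)) := by
  rw [← Equiv.sum_comp (Equiv.funUnique (Fin 1) (Fin (2 * k + 1))).symm]
  simp only [tentNet, ReLUNet.eval, neg_mul, add_mul, Finset.sum_neg_distrib,
    Finset.sum_add_distrib, sum_pick_mul, Pi.zero_apply, add_zero]
  refine Finset.sum_congr rfl fun i _ => ?_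
  have hi := i.2
  rw [entry_of_lt _ (show 3 * (i : ℕ) < 3 * (2 * k + 1) by omega),
    entry_of_lt _ (show 3 * (i : ℕ) + 1 < 3 * (2 * k + 1) by omega)]
  have e1 : (3 * (i : ℕ) + 1) % 3 = 1 := by omega
  have e2 : (3 * (i : ℕ) + 1) / 3 = i := by omega
  have e3 : 2 * (k : ℝ) * x + -(i : ℕ) = 2 * k * x - (i : ℕ) := by ring
  have e4 : -(2 * (k : ℝ)) * x + (i : ℕ) = -(2 * k * x - (i : ℕ)) := by ring
  simp only [kuhnBump, ciSup_unique, Nat.mul_mod_right, e1, e2, Nat.mul_div_cancel_left _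
    (show 0 < 3 by norm_num), if_true, one_ne_zero, if_false, Finset.univ_unique,
    Finset.sum_singleton, Equiv.funUnique_symm_apply, uniqueElim_const]
  rw [e3, e4, neg_add, show ∀ a b : ℝ, -a + -b + 1 = 1 - a - b by intros; ring]

/-! ### Approximation of continuously differentiable functions -/

theorem theorem2 :
    (∀ (n m k : ℕ), 2 ≤ n → 0 < k →
      ∀ q : ℕ, (q = Nat.clog 2 n ∨ q = Nat.log 2 n + 1) →
      ∀ f : (Fin n → ℝ) → ℝ, ContDiff ℝ 1 f →
        tsupport f ⊆ Set.Icc (0 : Fin n → ℝ) 1 →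
        ∃ N : ReLUNet n (hiddenWidths n k ((m + 5) * q)) 1,
          N.depth = (m + 5) * q + 3 ∧
          N.ConnectedWithin (localConnections n k ((m + 5) * q)) ∧
          ∀ x ∈ Set.Icc (0 : Fin n → ℝ) 1,
            |f x - N.eval x 0| ≤
              supNormOn (Set.Icc (0 : Fin n → ℝ) 1) f * 3 ^ n * (2 : ℝ) ^ (-(m : ℤ)) *
                  (2 * (k : ℝ) + 1) +
                (⨆ j : Fin n, supNormOn (Set.Icc (0 : Fin n → ℝ) 1) (partialDeriv j f)) *
                  (n : ℝ) / (2 * (k : ℝ))) ∧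
    (∀ k : ℕ, 0 < k →
      ∀ f : ℝ → ℝ, ContDiff ℝ 1 f → tsupport f ⊆ Set.Icc (0 : ℝ) 1 →
        ∃ N : ReLUNet 1 [3 * (2 * k + 1), 2 * k + 1] 1,
          N.ConnectedWithin [inputConn k, tripleConn] ∧
          ∀ x ∈ Set.Icc (0 : ℝ) 1,
            |f x - N.eval (fun _ => x) 0| ≤
              supNormOn (Set.Icc (0 : ℝ) 1) (deriv f) / (2 * (k : ℝ))) := by
  constructor
  · intro n m k hn hk q hq f hf _
    have : NeZero n := ⟨by omega⟩
    have hnq : n ≤ 2 ^ q := by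
      rcases hq with rfl | rfl
      · exact Nat.le_pow_clog one_lt_two n
      · exact (Nat.lt_pow_succ_log_self one_lt_two n).le
    have hq0 : 0 < q := Nat.pos_of_ne_zero fun h => by rw [h] at hnq; omega
    have hM : q < (m + 5) * q := by nlinarith
    generalize (m + 5) * q = M at hM
    obtain ⟨T, rfl⟩ : ∃ T, M = T + 1 := ⟨M - 1, by omega⟩
    refine ⟨interpolationNet n k T fun I => f fun j =>
        ((finFunctionFinEquiv.symm I j : Fin (2 * k + 1)) : ℕ) / (2 * k),
      by simp [ReLUNet.depth, hiddenWidths], interpolationNet_connectedWithin (by omega) k T _,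
      fun x hx => ?_⟩
    rw [interpolationNet_eval (hnq.trans (Nat.pow_le_pow_right two_pos (by omega))) _ hx.1]
    simp only [Equiv.symm_apply_apply]
    refine (abs_sub_interpolant_le hk hx fun z hz h =>
      abs_sub_le_of_contDiff hf hx hz (by positivity) h).trans ?_
    rw [mul_one_div]
    have := supNormOn_nonneg (Set.Icc (0 : Fin n → ℝ) 1) f
    exact le_add_of_nonneg_left (by positivity)
  · intro k hk f hf _
    refine ⟨tentNet k fun i => f ((i : ℕ) / (2 * k)), tentNet_connectedWithin k _,
      fun x hx => ?_⟩
    rw [tentNet_eval]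
    refine abs_sub_interpolant_le (n := 1) hk (f := fun y => f (y 0)) (x := fun _ => x)
      ⟨fun _ => hx.1, fun _ => hx.2⟩ fun z hz h => ?_
    have := (convex_Icc (0 : ℝ) 1).norm_image_sub_le_of_norm_deriv_le
      (fun w _ => (hf.differentiable one_ne_zero) w)
      (fun w hw => le_supNormOn isCompact_Icc (hf.continuous_deriv le_rfl) hw)
      ⟨hz.1 0, hz.2 0⟩ hx
    refine this.trans ?_
    rw [← mul_one_div]
    exact mul_le_mul_of_nonneg_left (h 0) (supNormOn_nonneg _ _)
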